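/- **Theorem (spectral stability for convex or concave fluxes).** Let $f\in C^\infty(\mathbb R;\mathbb R)$ be convex or concave on $\mathbb R$, and let $u_\ell,u_r\in\mathbb R$ satisfy the Rankine–Hugoniot relation $f(u_\ell)=f(u_r)$ and the entropy inequalities $f'(u_r)<0<f'(u_\ell)$. Let $\lambda>0$ (the ratio $\Delta t/\Delta x$), and set $$\alpha_\ell:=\lambda f'(u_\ell),\qquad \alpha_r:=\lambda f'(u_r),\qquad \alpha_m:=\lambda f'\Big(\frac{u_\ell+u_r}{2}\Big).$$ Assume the CFL condition $\max(\alpha_\ell,|\alpha_r|)<1$. For $q\in[1,+\infty]$ let $\mathscr L:\ell^q(\mathbb Z;\mathbb C)\to\ell^q(\mathbb Z;\mathbb C)$ be the bounded operator $$(\mathscr L w)_j=\begin{cases} w_j-\frac{\alpha_r}{2}(w_{j+1}-w_{j-1})+\frac{\alpha_r^2}{2}(w_{j+1}-2w_j+w_{j-1}), & j\ge 2,\\[2pt] w_j-\frac{\alpha_\ell}{2}(w_{j+1}-w_{j-1})+\frac{\alpha_\ell^2}{2}(w_{j+1}-2w_j+w_{j-1}), & j\le -1,\\[2pt] w_0-\frac12(\alpha_r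 w_1-\alpha_\ell w_{-1})+\frac12\big(\alpha_r\alpha_m w_1-\alpha_\ell(\alpha_\ell+\alpha_m)w_0+\alpha_\ell^2 w_{-1}\big), & j=0,\\[2pt] w_1-\frac12(\alpha_r w_2-\alpha_\ell w_0)+\frac12\big(\alpha_r^2 w_2-\alpha_r(\alpha_r+\alpha_m)w_1+\alpha_\ell\alpha_m w_0\big), & j=1, \end{cases}$$ that is, the linearization of the Lax–Wendroff scheme for $\partial_t u+\partial_x f(u)=0$ around the stationary discrete shock equal to $u_\ell$ for $j\le 0$ and to $u_r$ for $j\ge 1$. Then, for every $q\in[1,+\infty]$, the operator $\mathscr L$ on $\ell^q(\mathbb Z;\mathbb C)$ has no spectrum in $\{z\in\mathbb C : |z|\ge 1\}\setminus\{1\}$, and $1$ is an eigenvalue of $\mathscr L$ on $\ell^q(\mathbb Z;\mathbb C)$. -/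

import Mathlib

namespace LaxWendroff

/-- The (signed) Courant number `α = λ f'(u)` at the state `u`, with `λ = Δt/Δx`. -/
noncomputable def courant (f : ℝ → ℝ) (lam u : ℝ) : ℝ := lam * deriv f u

/-- The Lax-Wendroff scheme linearized around the discrete shock profile `u_ℓ` (for `j ≤ 0`),
`u_r` (for `j ≥ 1`), as an operation on arbitrary complex sequences. The parameters are the Courant
numbers `αl`, `αr` of the two end states and the Courant number `αm` of the midpoint state. -/
noncomputable def linearizedSeq (αl αm αr : ℝ) (w : ℤ → ℂ) (j : ℤ) : ℂ :=
  if 2 ≤ j then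
    w j - (αr / 2 : ℂ) * (w (j + 1) - w (j - 1))
      + ((αr : ℂ) ^ 2 / 2) * (w (j + 1) - 2 * w j + w (j - 1))
  else if j ≤ -1 then
    w j - (αl / 2 : ℂ) * (w (j + 1) - w (j - 1))
      + ((αl : ℂ) ^ 2 / 2) * (w (j + 1) - 2 * w j + w (j - 1))
  else if j = 0 then
    w 0 - (1 / 2 : ℂ) * (αr * w 1 - αl * w (-1))
      + (1 / 2 : ℂ) * (αr * αm * w 1 - αl * (αl + αm) * w 0 + (αl : ℂ) ^ 2 * w (-1))
  else
    w 1 - (1 / 2 : ℂ) * (αr * w 2 - αl * w 0)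
      + (1 / 2 : ℂ) * ((αr : ℂ) ^ 2 * w 2 - αr * (αr + αm) * w 1 + αl * αm * w 0)

/-- The space `ℓ^q(ℤ; ℂ)`. -/
abbrev SeqSpace (q : ENNReal) : Type := lp (fun _ : ℤ => ℂ) q

theorem memlp_shift {q : ENNReal} {w : ℤ → ℂ} (hw : Memℓp (E := fun _ : ℤ => ℂ) w q) (k : ℤ) :
    Memℓp (E := fun _ : ℤ => ℂ) (fun j => w (j + k)) q := by
  rcases q.trichotomy with rfl | rfl | hq
  · refine memℓp_zero ?_
    exact (memℓp_zero_iff.1 hw).preimage (f := fun j : ℤ => j + k)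
      (add_left_injective k).injOn
  · refine memℓp_infty ?_
    refine (memℓp_infty_iff.1 hw).mono ?_
    rintro _ ⟨j, rfl⟩
    exact ⟨j + k, rfl⟩
  · refine memℓp_gen ?_
    exact ((memℓp_gen_iff hq).1 hw).comp_injective (add_left_injective k)

theorem memlp_mul {q : ENNReal} {c w : ℤ → ℂ} {C : ℝ} (hc : ∀ j, ‖c j‖ ≤ C)
    (hw : Memℓp (E := fun _ : ℤ => ℂ) w q) :
    Memℓp (E := fun _ : ℤ => ℂ) (fun j => c j * w j) q := by
  rcases q.trichotomy with rfl | rfl | hq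
  · refine memℓp_zero ((memℓp_zero_iff.1 hw).subset ?_)
    intro j hj hj'
    exact hj (by simp [hj'])
  · obtain ⟨B, hB⟩ := memℓp_infty_iff.1 hw
    refine memℓp_infty ⟨C * B, ?_⟩
    rintro _ ⟨j, rfl⟩
    have h1 : ‖w j‖ ≤ B := hB ⟨j, rfl⟩
    calc ‖c j * w j‖ = ‖c j‖ * ‖w j‖ := norm_mul _ _
      _ ≤ C * B := mul_le_mul (hc j) h1 (norm_nonneg _) ((norm_nonneg _).trans (hc j))
  · refine memℓp_gen ?_
    refine Summable.of_nonneg_of_le (fun j => by positivity) (fun j => ?_)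
      (((memℓp_gen_iff hq).1 hw).mul_left (C ^ q.toReal))
    have hC : 0 ≤ C := (norm_nonneg _).trans (hc j)
    rw [norm_mul, Real.mul_rpow (norm_nonneg _) (norm_nonneg _)]
    exact mul_le_mul_of_nonneg_right
      (Real.rpow_le_rpow (norm_nonneg _) (hc j) hq.le) (by positivity)

/-- The sequence operation preserves `ℓ^q`. -/
theorem memlp_linearizedSeq {q : ENNReal} (αl αm αr : ℝ) {w : ℤ → ℂ}
    (hw : Memℓp (E := fun _ : ℤ => ℂ) w q) :
    Memℓp (E := fun _ : ℤ => ℂ) (linearizedSeq αl αm αr w) q := by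
  let sel : (ℂ × ℂ × ℂ × ℂ) → ℤ → ℂ := fun p j =>
    if 2 ≤ j then p.1 else if j ≤ -1 then p.2.1 else if j = 0 then p.2.2.1 else p.2.2.2
  have hsel : ∀ p j, ‖sel p j‖ ≤ ‖p.1‖ + ‖p.2.1‖ + ‖p.2.2.1‖ + ‖p.2.2.2‖ := by
    intro p j
    have h1 := norm_nonneg p.1
    have h2 := norm_nonneg p.2.1
    have h3 := norm_nonneg p.2.2.1
    have h4 := norm_nonneg p.2.2.2
    simp only [sel]
    split_ifs <;> linarith
  let a : ℂ × ℂ × ℂ × ℂ := ((αr / 2 + αr ^ 2 / 2), (αl / 2 + αl ^ 2 / 2),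
    (αl / 2 + αl ^ 2 / 2), (αl / 2 + αl * αm / 2))
  let b : ℂ × ℂ × ℂ × ℂ := ((1 - αr ^ 2), (1 - αl ^ 2),
    (1 - αl * (αl + αm) / 2), (1 - αr * (αr + αm) / 2))
  let c : ℂ × ℂ × ℂ × ℂ := ((-αr / 2 + αr ^ 2 / 2), (-αl / 2 + αl ^ 2 / 2),
    (-αr / 2 + αr * αm / 2), (-αr / 2 + αr ^ 2 / 2))
  have h := ((memlp_mul (hsel a) (memlp_shift hw (-1))).add (memlp_mul (hsel b) hw)).add
    (memlp_mul (hsel c) (memlp_shift hw 1))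
  convert h using 1
  funext j
  simp only [linearizedSeq, Pi.add_apply, sel, a, b, c]
  split_ifs with h1 h2 h3
  · simp only [← sub_eq_add_neg]; ring
  · simp only [← sub_eq_add_neg]; ring
  · subst h3; norm_num; ring
  · obtain rfl : j = 1 := by omega
    norm_num; ring

/-- The sequence operation as a linear endomorphism of `ℓ^q`. -/
noncomputable def linearizedLinearMap (q : ENNReal) [Fact (1 ≤ q)] (αl αm αr : ℝ) :
    SeqSpace q →ₗ[ℂ] SeqSpace q where
  toFun w := ⟨linearizedSeq αl αm αr w, memlp_linearizedSeq αl αm αr (lp.memℓp w)⟩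
  map_add' v w := by
    apply lp.ext
    funext j
    simp only [lp.coeFn_add, Pi.add_apply, linearizedSeq]
    split_ifs <;> ring
  map_smul' c w := by
    apply lp.ext
    funext j
    simp only [lp.coeFn_smul, Pi.smul_apply, smul_eq_mul, linearizedSeq, RingHom.id_apply]
    split_ifs <;> ring

theorem continuous_linearizedSeq {X : Type*} [TopologicalSpace X] (αl αm αr : ℝ) (j : ℤ)
    {g : X → ℤ → ℂ} (hg : ∀ i, Continuous fun x => g x i) :
    Continuous fun x => linearizedSeq αl αm αr (g x) j := by
  unfold linearizedSeq
  split_ifs <;> fun_prop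

theorem continuous_linearizedLinearMap (q : ENNReal) [Fact (1 ≤ q)] (αl αm αr : ℝ) :
    Continuous (linearizedLinearMap q αl αm αr) := by
  apply LinearMap.continuous_of_seq_closed_graph
  intro u x y hu hLu
  have ev : ∀ (j : ℤ), Continuous fun w : SeqSpace q => w j := fun j =>
    (lp.lipschitzWith_one_eval q j).continuous
  apply lp.ext
  funext j
  have h1 := ((ev j).tendsto y).comp hLu
  have hc : Continuous fun w : SeqSpace q => linearizedSeq αl αm αr w j :=
    continuous_linearizedSeq αl αm αr j ev
  exact tendsto_nhds_unique h1 ((hc.tendsto x).comp hu)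

/-- The linearized Lax-Wendroff operator `𝓛` as a bounded operator on `ℓ^q(ℤ; ℂ)`. -/
noncomputable def linearizedOp (q : ENNReal) [Fact (1 ≤ q)] (αl αm αr : ℝ) :
    SeqSpace q →L[ℂ] SeqSpace q where
  toLinearMap := linearizedLinearMap q αl αm αr
  cont := continuous_linearizedLinearMap q αl αm αr

end LaxWendroff

namespace LaxWendroff

/-! Put `a = αl`, `b = -αr`, `m = αm`. Entropy and CFL give `0 < a, b < 1`, and monotonicity of `f'`
gives `|m| < 1`. Away from `j = 0, 1` the equation `z w - 𝓛 w = g` is a recurrence with constant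
coefficients on each side. For `|z| ≥ 1`, `z ≠ 1`, its two characteristic roots are separated by the
unit circle (`exists_charRoots`), so each side carries exactly one decaying mode. Rows `0` and `1`
couple the two amplitudes by a 2×2 system.

The coordinate `t = x / (1 - x) + (1 - a) / 2` turns `|z| ≥ 1` into a half-plane condition on
decaying roots (`IsCharRoot.re_pos`). The same bound shows that the determinant does not vanish
(`lopatinskii_ne_zero`), hence `z - 𝓛` is bijective. At `z = 1` decaying modes still exist but the
determinant vanishes, which produces an eigenvector. -/

/-! ### Location of the characteristic roots. -/

/-- `x` is a root of the characteristic polynomial at the spectral parameter `z`. -/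
def IsCharRoot (a : ℝ) (z x : ℂ) : Prop :=
  ((a : ℂ) + a ^ 2) * x ^ 2 - (2 * a ^ 2 + 2 * (z - 1)) * x + (a ^ 2 - a) = 0

theorem IsCharRoot.ne_one {a : ℝ} {z x : ℂ} (h : IsCharRoot a z x) (hz : z ≠ 1) : x ≠ 1 := by
  rintro rfl
  unfold IsCharRoot at h
  exact hz (by linear_combination (-1 / 2 : ℂ) * h)

theorem IsCharRoot.ne_zero {a : ℝ} {z x : ℂ} (ha0 : 0 < a) (ha1 : a < 1)
    (h : IsCharRoot a z x) : x ≠ 0 := by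
  rintro rfl
  unfold IsCharRoot at h
  have h1 : ((a ^ 2 - a : ℝ) : ℂ) = 0 := by push_cast; linear_combination h
  have h2 : a ^ 2 - a = 0 := by exact_mod_cast h1
  nlinarith

/-- The map `x ↦ x / (1 - x)` sends the closed disc minus `1` to the half-plane `Re ≥ -1/2`; this is
the quantitative form. -/
theorem two_mul_re_div_one_sub {x : ℂ} (hx : x ≠ 1) :
    2 * (x / (1 - x)).re + 1 = (1 - ‖x‖ ^ 2) / ‖1 - x‖ ^ 2 := by
  have h : (1 - x.re) * (1 - x.re) + x.im * x.im ≠ 0 := by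
    have := Complex.normSq_pos.2 (sub_ne_zero.2 hx.symm)
    simp only [Complex.normSq_apply, Complex.sub_re, Complex.sub_im, Complex.one_re,
      Complex.one_im] at this
    nlinarith
  rw [Complex.div_re, ← Complex.normSq_eq_norm_sq, ← Complex.normSq_eq_norm_sq]
  simp only [Complex.normSq_apply, Complex.sub_re, Complex.sub_im, Complex.one_re,
      Complex.one_im, zero_sub, neg_mul_neg]
  generalize hD : (1 - x.re) * (1 - x.re) + x.im * x.im = D at h ⊢
  field_simp
  linear_combination -hD

/-- With `u = Re t`, squaring the norm inequality gives `(2u + a)|t|² ≤ 2ku`. The left side is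
nonnegative, so `u ≥ 0`; and `u = 0` would force `a|t|² ≤ 0`. -/
theorem re_pos_of_norm_le {a k : ℝ} {t : ℂ} (ha : 0 < a) (hk : 0 < k) (ht : t ≠ 0)
    (hre : -a / 2 ≤ t.re) (h : ‖t ^ 2 - k + a * t‖ ≤ ‖t ^ 2 - k‖) : 0 < t.re := by
  have h2 := pow_le_pow_left₀ (norm_nonneg _) h 2
  rw [← Complex.normSq_eq_norm_sq, ← Complex.normSq_eq_norm_sq] at h2
  have hN := Complex.normSq_pos.2 ht
  simp only [Complex.normSq_apply, Complex.sub_re, Complex.sub_im, Complex.add_re, Complex.add_im,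
    Complex.mul_re, Complex.mul_im, Complex.ofReal_re, Complex.ofReal_im, pow_two] at h2 hN
  set u := t.re
  set v := t.im
  have h3 : a * ((2 * u + a) * (u * u + v * v) - 2 * k * u) ≤ 0 := by linarith
  have h4 : (2 * u + a) * (u * u + v * v) - 2 * k * u ≤ 0 := nonpos_of_mul_nonpos_right h3 ha
  by_contra! hu
  have h5 : 0 ≤ (2 * u + a) * (u * u + v * v) := mul_nonneg (by linarith) hN.le
  have h6 : u = 0 := by nlinarith
  rw [h6] at h4 hN
  nlinarith

theorem re_add_half {a : ℝ} (s : ℂ) : (s + (1 - a) / 2).re = s.re + (1 - a) / 2 := by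
  rw [Complex.add_re]
  congr 1
  have : ((1 - a) / 2 : ℂ) = ((1 - a) / 2 : ℝ) := by push_cast; ring
  rw [this, Complex.ofReal_re]

/-- A characteristic root in the closed unit disc has `Re (x / (1 - x)) > -(1 - a) / 2`. -/
theorem IsCharRoot.re_pos {a : ℝ} {z x : ℂ} (ha0 : 0 < a) (ha1 : a < 1) (hz : 1 ≤ ‖z‖)
    (hz1 : z ≠ 1) (h : IsCharRoot a z x) (hx : ‖x‖ ≤ 1) :
    0 < (x / (1 - x) + (1 - a) / 2).re := by
  have hx1 := h.ne_one hz1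
  have hx1' : 1 - x ≠ 0 := sub_ne_zero.2 hx1.symm
  have hk : 0 < (1 - a ^ 2) / 4 := by nlinarith
  set t : ℂ := x / (1 - x) + (1 - a) / 2 with ht
  -- The characteristic equation in the coordinate `t`: `z` is a quotient whose modulus can be
  -- compared with `1`.
  have hrel : z * (t ^ 2 - ((1 - a ^ 2) / 4 : ℝ) + a * t) = t ^ 2 - ((1 - a ^ 2) / 4 : ℝ) := by
    unfold IsCharRoot at h
    rw [ht]
    push_cast
    field_simp
    linear_combination (-8 : ℂ) * h
  refine re_pos_of_norm_le ha0 hk ?_ ?_ ?_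
  · intro h0
    rw [h0] at hrel
    have hk' : (((1 - a ^ 2) / 4 : ℝ) : ℂ) ≠ 0 := by exact_mod_cast hk.ne'
    exact hz1 (mul_right_cancel₀ hk' (by linear_combination -hrel))
  · have h1 := two_mul_re_div_one_sub hx1
    have h2 : 0 ≤ (1 - ‖x‖ ^ 2) / ‖1 - x‖ ^ 2 :=
      div_nonneg (by nlinarith [norm_nonneg x]) (by positivity)
    have h3 : t.re = (x / (1 - x)).re + (1 - a) / 2 := re_add_half _
    linarith
  · have h1 := congrArg norm hrel
    rw [norm_mul] at h1
    rw [← h1]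
    exact le_mul_of_one_le_left (norm_nonneg (_ : ℂ)) hz

/-- Multiplying `s * t = -k` by the conjugate of `s` and taking real parts gives `|s|² Re t = -k Re
s`, with opposite signs. -/
theorem not_mul_eq_neg_of_re_pos {k : ℝ} {s t : ℂ} (hk : 0 < k) (hs : 0 < s.re) (ht : 0 < t.re) :
    s * t ≠ -k := by
  intro h
  have h1 := congrArg Complex.re h
  have h2 := congrArg Complex.im h
  simp only [Complex.mul_re, Complex.mul_im, Complex.neg_re, Complex.neg_im, Complex.ofReal_re,
    Complex.ofReal_im, neg_zero] at h1 h2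
  have h3 : s.re * (s.re * t.re) + s.im * s.im * t.re = -k * s.re := by
    linear_combination s.re * h1 + s.im * h2
  have := mul_pos hs (mul_pos hs ht)
  have := mul_nonneg (mul_self_nonneg s.im) ht.le
  nlinarith

/-- Outside the open unit disc and away from `1`, the characteristic polynomial has exactly one
root in the open unit disc, and none on the unit circle. -/
theorem exists_charRoots {a : ℝ} {z : ℂ} (ha0 : 0 < a) (ha1 : a < 1) (hz : 1 ≤ ‖z‖)
    (hz1 : z ≠ 1) : ∃ x x' : ℂ, ‖x‖ < 1 ∧ 1 < ‖x'‖ ∧ IsCharRoot a z x ∧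
      (a + a ^ 2) * (x + x') = 2 * a ^ 2 + 2 * (z - 1) ∧
      (a + a ^ 2) * (x * x') = a ^ 2 - a := by
  have hA : (a + a ^ 2 : ℂ) ≠ 0 := by
    have : a + a ^ 2 ≠ 0 := by positivity
    exact_mod_cast this
  have ha1c : (1 + a : ℂ) ≠ 0 := by
    have : 1 + a ≠ 0 := by positivity
    exact_mod_cast this
  have hac : (a : ℂ) ≠ 0 := by exact_mod_cast ha0.ne'
  obtain ⟨x, hx⟩ : ∃ x, IsCharRoot a z x := by
    obtain ⟨s, hs⟩ := IsAlgClosed.exists_pow_nat_eq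
      (discrim (a + a ^ 2 : ℂ) (-(2 * a ^ 2 + 2 * (z - 1))) (a ^ 2 - a)) (n := 2) two_pos
    obtain ⟨x, hx⟩ := exists_quadratic_eq_zero hA ⟨s, by rw [← hs, pow_two]⟩
    exact ⟨x, by unfold IsCharRoot; linear_combination hx⟩
  -- In the coordinate `t` the two roots have product `-(1 - a²)/4`, so they cannot both have
  -- positive real part.
  have key : ∀ x x' : ℂ, ‖x‖ < 1 → IsCharRoot a z x → IsCharRoot a z x' →
      (a + a ^ 2) * (x * x') = a ^ 2 - a → 1 < ‖x'‖ := by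
    intro x x' hx hr hr' hp
    by_contra! hx'
    have h1 := hr.re_pos ha0 ha1 hz hz1 hx.le
    have h2 := hr'.re_pos ha0 ha1 hz hz1 hx'
    have e1 : 1 - x ≠ 0 := sub_ne_zero.2 (hr.ne_one hz1).symm
    have e2 : 1 - x' ≠ 0 := sub_ne_zero.2 (hr'.ne_one hz1).symm
    have hp' : (1 + a) * (x * x') = a - 1 :=
      mul_left_cancel₀ hac (by linear_combination hp)
    refine not_mul_eq_neg_of_re_pos (k := (1 - a ^ 2) / 4) (by nlinarith) h1 h2 ?_
    push_cast
    field_simp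
    linear_combination 8 * hp'
  set x' : ℂ := (2 * a ^ 2 + 2 * (z - 1)) / (a + a ^ 2) - x with hx'
  have hsum : (a + a ^ 2) * (x + x') = 2 * a ^ 2 + 2 * (z - 1) := by
    rw [hx']; field_simp; ring
  have hprod : (a + a ^ 2) * (x * x') = a ^ 2 - a := by
    unfold IsCharRoot at hx
    linear_combination x * hsum - hx
  have hr' : IsCharRoot a z x' := by
    unfold IsCharRoot
    linear_combination x' * hsum - hprod
  by_cases h : ‖x‖ < 1
  · exact ⟨x, x', h, key x x' h hx hr' hprod, hx, hsum, hprod⟩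
  · have h' : ‖x'‖ < 1 := by
      by_contra! h'
      -- The product of the roots is `(a - 1)/(1 + a)`, so at least one root lies inside the disc.
      have h3 : ‖x * x'‖ < 1 := by
        have h4 : x * x' = ((a - 1) / (1 + a) : ℝ) := by
          push_cast
          rw [eq_div_iff ha1c]
          exact mul_left_cancel₀ hac (by linear_combination hprod)
        rw [h4, Complex.norm_real, Real.norm_eq_abs, abs_lt]
        constructor
        · rw [lt_div_iff₀ (by linarith)]; linarith
        · rw [div_lt_iff₀ (by linarith)]; linarith
      rw [norm_mul] at h3
      nlinarith
    have hp2 : (a + a ^ 2) * (x' * x) = a ^ 2 - a := by rw [mul_comm x', hprod]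
    exact ⟨x', x, h', key x' x h' hr' hx hp2, hr', by rw [add_comm x', hsum], hp2⟩

/-! ### Matching conditions at the shock. -/

/-- The matching coefficient `1 / P` of a decaying mode has real part above `-1 / 2`. -/
theorem IsCharRoot.matching_re {a : ℝ} {z x : ℂ} (ha0 : 0 < a) (ha1 : a < 1) (hz : 1 ≤ ‖z‖)
    (hz1 : z ≠ 1) (h : IsCharRoot a z x) (hx : ‖x‖ < 1) :
    ∃ p : ℂ, -1 / 2 < p.re ∧ p * ((1 - a) * (1 - x)) = x := by
  have h1 := h.re_pos ha0 ha1 hz hz1 hx.le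
  have hx1 : 1 - x ≠ 0 := sub_ne_zero.2 (h.ne_one hz1).symm
  have ha : (1 - a : ℂ) ≠ 0 := by
    have : 1 - a ≠ 0 := by linarith
    exact_mod_cast this
  rw [re_add_half] at h1
  refine ⟨x / (1 - x) / (1 - a : ℝ), ?_, ?_⟩
  · rw [Complex.div_ofReal_re, lt_div_iff₀ (by linarith)]
    linarith
  · push_cast; field_simp

/-- Nonvanishing of the Lopatinskii determinant of the matching conditions at `j = 0, 1`. -/
theorem lopatinskii_ne_zero {a b m : ℝ} {z x y : ℂ} (ha0 : 0 < a) (ha1 : a < 1) (hb0 : 0 < b)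
    (hb1 : b < 1) (hm : |m| < 1) (hz : 1 ≤ ‖z‖) (hz1 : z ≠ 1) (hx : IsCharRoot a z x)
    (hy : IsCharRoot b z y) (hx1 : ‖x‖ < 1) (hy1 : ‖y‖ < 1) :
    (2 * (z - 1) - (a * x - a ^ 2 - a * m + a ^ 2 * x)) *
      (2 * (z - 1) - (b * y + b ^ 2 * y - b ^ 2 + b * m)) - (b * (1 - m)) * (a * (1 + m)) ≠ 0 := by
  obtain ⟨p, hp, hpx⟩ := hx.matching_re ha0 ha1 hz hz1 hx1
  obtain ⟨r, hr, hry⟩ := hy.matching_re hb0 hb1 hz hz1 hy1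
  have hx0 := hx.ne_zero ha0 ha1
  have hy0 := hy.ne_zero hb0 hb1
  have hac : (a : ℂ) ≠ 0 := by exact_mod_cast ha0.ne'
  have hbc : (b : ℂ) ≠ 0 := by exact_mod_cast hb0.ne'
  -- The characteristic equation eliminates `z`: the diagonal entry times `p` is affine in `p`.
  have e1 : p * (2 * (z - 1) - (a * x - a ^ 2 - a * m + a ^ 2 * x)) = a * (p * (m - 1) - 1) := by
    refine mul_left_cancel₀ hx0 ?_
    unfold IsCharRoot at hx
    linear_combination (-p) * hx - a * hpx
  have e2 : r * (2 * (z - 1) - (b * y + b ^ 2 * y - b ^ 2 + b * m)) = b * (r * (-m - 1) - 1) := by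
    refine mul_left_cancel₀ hy0 ?_
    unfold IsCharRoot at hy
    linear_combination (-r) * hy - b * hry
  intro h
  -- The `p * r` terms cancel in `p * r * det`. The real part of the remaining factor exceeds `1 -
  -- (1 - m)/2 - (1 + m)/2 = 0`.
  have h1 : (a * b : ℂ) * (1 + (1 - m : ℝ) * p + (1 + m : ℝ) * r) = 0 := by
    push_cast
    linear_combination p * r * h - r * (2 * (z - 1) - (b * y + b ^ 2 * y - b ^ 2 + b * m)) * e1
      - a * (p * (m - 1) - 1) * e2
  have h2 := (mul_eq_zero.1 h1).resolve_left (mul_ne_zero hac hbc)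
  have h3 := congrArg Complex.re h2
  simp only [Complex.add_re, Complex.one_re, Complex.re_ofReal_mul, Complex.zero_re] at h3
  obtain ⟨hm1, hm2⟩ := abs_lt.1 hm
  nlinarith [mul_pos (show 0 < 1 - m by linarith) (show 0 < p.re + 1 / 2 by linarith),
    mul_pos (show 0 < 1 + m by linarith) (show 0 < r.re + 1 / 2 by linarith)]

/-! ### Constant-coefficient recurrences on `ℓ^q`. -/

theorem norm_shift_le {q : ENNReal} [Fact (1 ≤ q)] (w : SeqSpace q) (k : ℤ) :
    ‖(⟨fun j => w (j + k), memlp_shift (lp.memℓp w) k⟩ : SeqSpace q)‖ ≤ ‖w‖ := by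
  rcases q.trichotomy with rfl | rfl | hq
  · exact absurd (Fact.out : (1 : ENNReal) ≤ 0) (by simp)
  · exact lp.norm_le_of_forall_le (norm_nonneg _) fun j => lp.norm_apply_le_norm (by simp) w (j + k)
  · rw [lp.norm_eq_tsum_rpow hq, lp.norm_eq_tsum_rpow hq]
    exact (congrArg (· ^ (1 / q.toReal))
      ((Equiv.addRight k).tsum_eq fun j => ‖w j‖ ^ q.toReal)).le

/-- The bilateral shift `(shift k w)_j = w_{j+k}` on `ℓ^q(ℤ)`. -/
noncomputable def shift (q : ENNReal) [Fact (1 ≤ q)] (k : ℤ) : SeqSpace q →L[ℂ] SeqSpace q :=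
  LinearMap.mkContinuous
    { toFun := fun w => ⟨fun j => w (j + k), memlp_shift (lp.memℓp w) k⟩
      map_add' := fun _ _ => lp.ext rfl
      map_smul' := fun _ _ => lp.ext rfl } 1
    fun w => by rw [one_mul]; exact norm_shift_le w k

@[simp] theorem shift_apply (q : ENNReal) [Fact (1 ≤ q)] (k : ℤ) (w : SeqSpace q) (j : ℤ) :
    shift q k w j = w (j + k) := rfl

theorem norm_shift_le_one (q : ENNReal) [Fact (1 ≤ q)] (k : ℤ) : ‖shift q k‖ ≤ 1 :=
  LinearMap.mkContinuous_norm_le _ zero_le_one _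

theorem exists_sub_smul_shift {q : ENNReal} [Fact (1 ≤ q)] {κ : ℂ} (hκ : ‖κ‖ < 1) (k : ℤ)
    (g : SeqSpace q) : ∃ w : SeqSpace q, ∀ j, w j - κ * w (j + k) = g j := by
  have hlt : ‖κ • shift q k‖ < 1 := by
    rw [norm_smul]
    nlinarith [norm_shift_le_one q k, norm_nonneg κ, norm_nonneg (shift q k)]
  obtain ⟨u, hu⟩ := isUnit_one_sub_of_norm_lt_one hlt
  refine ⟨(↑u⁻¹ : SeqSpace q →L[ℂ] SeqSpace q) g, fun j => ?_⟩
  have h : ((↑u : SeqSpace q →L[ℂ] SeqSpace q) * ↑u⁻¹) g = g := by rw [Units.mul_inv]; rfl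
  rw [hu] at h
  exact congrFun (congrArg (fun w : SeqSpace q => (w : ℤ → ℂ)) h) j

/-- Shifts are contractions, so a Neumann series applies after factoring out the shift when `‖κ‖ <
1`, or `-κ` when `‖κ‖ > 1`. -/
theorem exists_shift_sub {q : ENNReal} [Fact (1 ≤ q)] {κ : ℂ} (hκ : ‖κ‖ ≠ 1) (k : ℤ)
    (g : SeqSpace q) : ∃ w : SeqSpace q, ∀ j, w (j + k) - κ * w j = g j := by
  rcases lt_or_gt_of_ne hκ with h | h
  · obtain ⟨w, hw⟩ := exists_sub_smul_shift h (-k) (shift q (-k) g)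
    refine ⟨w, fun j => ?_⟩
    have := hw (j + k)
    simpa [add_assoc] using this
  · have hκ0 : κ ≠ 0 := by
      rintro rfl
      simp at h
      linarith
    obtain ⟨w, hw⟩ := exists_sub_smul_shift (κ := κ⁻¹)
      (by rw [norm_inv]; exact inv_lt_one_of_one_lt₀ h) k ((-κ⁻¹) • g)
    refine ⟨w, fun j => ?_⟩
    have h1 := hw j
    have h2 : ((-κ⁻¹) • g : SeqSpace q) j = -κ⁻¹ * g j := rfl
    rw [h2] at h1
    field_simp at h1
    linear_combination -h1

/-- The operator factors into two first-order ones, one for each root. -/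
theorem exists_secondOrder {q : ENNReal} [Fact (1 ≤ q)] {κ κ' : ℂ} (hκ : ‖κ‖ ≠ 1)
    (hκ' : ‖κ'‖ ≠ 1) (k : ℤ) (g : SeqSpace q) : ∃ w : SeqSpace q, ∀ j,
      w (j + k) - (κ + κ') * w j + κ * κ' * w (j - k) = g j := by
  obtain ⟨v, hv⟩ := exists_shift_sub hκ k g
  obtain ⟨w, hw⟩ := exists_shift_sub hκ' k (shift q k v)
  refine ⟨w, fun j => ?_⟩
  have h1 := hw j
  have h2 := hw (j - k)
  simp only [shift_apply, sub_add_cancel] at h1 h2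
  linear_combination h1 - κ * h2 + hv j

/-- A bounded solution of a second order recurrence with one root inside and one root outside the
unit disc is geometric. -/
theorem eq_mul_pow_of_bounded {κ κ' : ℂ} (hκ' : 1 < ‖κ'‖) {u : ℕ → ℂ} {B : ℝ}
    (hB : ∀ n, ‖u n‖ ≤ B) (hrec : ∀ n, u (n + 2) - (κ + κ') * u (n + 1) + κ * κ' * u n = 0) :
    ∀ n, u n = u 0 * κ ^ n := by
  -- Removing the factor `κ` leaves a sequence multiplied by `κ'` at each step; boundedness then
  -- forces it to vanish.
  have hv : ∀ n, u (n + 1) - κ * u n = κ' ^ n * (u 1 - κ * u 0) := by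
    intro n
    induction n with
    | zero => simp
    | succ n ih => rw [pow_succ]; linear_combination hrec n + κ' * ih
  have h0 : u 1 - κ * u 0 = 0 := by
    by_contra hne
    have hpos := norm_pos_iff.2 hne
    obtain ⟨n, hn⟩ := pow_unbounded_of_one_lt ((B + ‖κ‖ * B) / ‖u 1 - κ * u 0‖) hκ'
    rw [div_lt_iff₀ hpos, ← norm_pow, ← norm_mul, ← hv n] at hn
    refine absurd hn (not_lt.2 ((norm_sub_le _ _).trans ?_))
    rw [norm_mul]
    exact add_le_add (hB _) (mul_le_mul_of_nonneg_left (hB _) (norm_nonneg _))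
  intro n
  induction n with
  | zero => simp
  | succ n ih =>
    have := hv n
    rw [h0, mul_zero] at this
    rw [pow_succ]
    linear_combination this + κ * ih

/-! ### Sequences glued at the shock, and the rows of the operator. -/

/-- The sequence equal to `c κ^{-j}` for `j ≤ 0` and to `d μ^{j-1}` for `j ≥ 1`. -/
noncomputable def twoSidedGeom (c κ d μ : ℂ) (j : ℤ) : ℂ :=
  if j ≤ 0 then c * κ ^ (-j).toNat else d * μ ^ (j - 1).toNat

theorem memlp_twoSidedGeom {q : ENNReal} (hq : 1 ≤ q) (c d : ℂ) {κ μ : ℂ} (hκ : ‖κ‖ < 1)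
    (hμ : ‖μ‖ < 1) : Memℓp (E := fun _ : ℤ => ℂ) (twoSidedGeom c κ d μ) q := by
  refine Memℓp.of_exponent_ge (q := 1) ?_ hq
  refine memℓp_gen ?_
  simp only [ENNReal.toReal_one, Real.rpow_one]
  refine Summable.of_nat_of_neg ?_ ?_
  · rw [← summable_nat_add_iff 1]
    refine ((summable_geometric_of_lt_one (norm_nonneg μ) hμ).mul_left ‖d‖).congr fun n => ?_
    rw [twoSidedGeom, if_neg (by push_cast; omega), norm_mul, norm_pow]
    congr 2
    push_cast; omega
  · refine ((summable_geometric_of_lt_one (norm_nonneg κ) hκ).mul_left ‖c‖).congr fun n => ?_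
    rw [twoSidedGeom, if_pos (by omega), norm_mul, norm_pow]
    congr 2
    omega

/-- Gluing of two sequences at the shock: the first for `j ≤ 0`, the second for `j ≥ 1`. -/
theorem memlp_glue {q : ENNReal} {u v : ℤ → ℂ} (hu : Memℓp (E := fun _ : ℤ => ℂ) u q)
    (hv : Memℓp (E := fun _ : ℤ => ℂ) v q) :
    Memℓp (E := fun _ : ℤ => ℂ) (fun j => if j ≤ 0 then u j else v j) q := by
  have h1 := memlp_mul (c := fun j : ℤ => if j ≤ 0 then 1 else 0) (C := 1)
    (fun j => by split_ifs <;> simp) hu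
  have h2 := memlp_mul (c := fun j : ℤ => if j ≤ 0 then 0 else 1) (C := 1)
    (fun j => by split_ifs <;> simp) hv
  convert h1.add h2 using 1
  funext j
  simp only [Pi.add_apply]
  split_ifs <;> simp

section Rows

variable (a m b : ℝ) (w : ℤ → ℂ)

theorem linearizedSeq_of_two_le {j : ℤ} (hj : 2 ≤ j) :
    linearizedSeq a m (-b) w j = w j + (b / 2) * (w (j + 1) - w (j - 1))
      + (b ^ 2 / 2) * (w (j + 1) - 2 * w j + w (j - 1)) := by
  rw [linearizedSeq, if_pos hj]; push_cast; ring

theorem linearizedSeq_of_le_neg_one {j : ℤ} (hj : j ≤ -1) :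
    linearizedSeq a m (-b) w j = w j - (a / 2) * (w (j + 1) - w (j - 1))
      + (a ^ 2 / 2) * (w (j + 1) - 2 * w j + w (j - 1)) := by
  rw [linearizedSeq, if_neg (by omega), if_pos hj]

theorem linearizedSeq_zero :
    linearizedSeq a m (-b) w 0 = w 0 + (1 / 2) * (b * w 1 + a * w (-1))
      + (1 / 2) * (-b * m * w 1 - a * (a + m) * w 0 + a ^ 2 * w (-1)) := by
  simp only [linearizedSeq]; norm_num; ring

theorem linearizedSeq_one :
    linearizedSeq a m (-b) w 1 = w 1 + (1 / 2) * (b * w 2 + a * w 0)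
      + (1 / 2) * (b ^ 2 * w 2 + b * (m - b) * w 1 + a * m * w 0) := by
  simp only [linearizedSeq]; norm_num; ring

end Rows

variable {a b m : ℝ} {z : ℂ} {q : ENNReal}

/-! ### Bijectivity of `z - 𝓛`. -/

theorem resolvent_injective [Fact (1 ≤ q)] (ha0 : 0 < a) (ha1 : a < 1) (hb0 : 0 < b)
    (hb1 : b < 1) (hm : |m| < 1) (hz : 1 ≤ ‖z‖) (hz1 : z ≠ 1) (w : SeqSpace q)
    (hw : ∀ j, z * w j - linearizedSeq a m (-b) w j = 0) : w = 0 := by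
  obtain ⟨x, x', hx1, hx1', hx, hsx, hpx⟩ := exists_charRoots ha0 ha1 hz hz1
  obtain ⟨y, y', hy1, hy1', hy, hsy, hpy⟩ := exists_charRoots hb0 hb1 hz hz1
  have hA : (a + a ^ 2 : ℂ) ≠ 0 := by
    have : a + a ^ 2 ≠ 0 := by positivity
    exact_mod_cast this
  have hB : (b + b ^ 2 : ℂ) ≠ 0 := by
    have : b + b ^ 2 ≠ 0 := by positivity
    exact_mod_cast this
  have hq0 : q ≠ 0 := (zero_lt_one.trans_le (Fact.out : 1 ≤ q)).ne'
  have hbd : ∀ j, ‖w j‖ ≤ ‖w‖ := lp.norm_apply_le_norm hq0 w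
  have hl := eq_mul_pow_of_bounded (κ := x) hx1' (u := fun n : ℕ => w (-n)) (fun n => hbd _) (by
    intro n
    refine mul_left_cancel₀ hA ?_
    have h := hw (-(n + 1 : ℕ))
    rw [linearizedSeq_of_le_neg_one _ _ _ _ (by omega)] at h
    have e1 : (-(n + 1 : ℕ) : ℤ) + 1 = -n := by push_cast; ring
    have e2 : (-(n + 1 : ℕ) : ℤ) - 1 = -(n + 2 : ℕ) := by push_cast; ring
    rw [e1, e2] at h
    linear_combination (-2 : ℂ) * h - w (-(n + 1 : ℕ)) * hsx + w (-n) * hpx)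
  have hr := eq_mul_pow_of_bounded (κ := y) hy1' (u := fun n : ℕ => w (n + 1)) (fun n => hbd _) (by
    intro n
    refine mul_left_cancel₀ hB ?_
    have h := hw ((n + 1 : ℕ) + 1)
    rw [linearizedSeq_of_two_le _ _ _ _ (by omega)] at h
    have e1 : ((n + 1 : ℕ) : ℤ) + 1 + 1 = (n + 2 : ℕ) + 1 := by push_cast; ring
    have e2 : ((n + 1 : ℕ) : ℤ) + 1 - 1 = n + 1 := by push_cast; ring
    rw [e1, e2] at h
    linear_combination (-2 : ℂ) * h - w ((n + 1 : ℕ) + 1) * hsy + w (n + 1) * hpy)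
  have hl1 : w (-1) = w 0 * x := by simpa using hl 1
  have hr1 : w 2 = w 1 * y := by simpa using hr 1
  have hdet := lopatinskii_ne_zero ha0 ha1 hb0 hb1 hm hz hz1 hx hy hx1 hy1
  have r0 := hw 0
  have r1 := hw 1
  rw [linearizedSeq_zero, hl1] at r0
  rw [linearizedSeq_one, hr1] at r1
  -- Rows `0` and `1` form a homogeneous system in `w 0`, `w 1`; each combination below eliminates
  -- one unknown.
  have h0 : w 0 = 0 := by
    refine (mul_eq_zero.1 ?_).resolve_left hdet
    linear_combination 2 * (2 * (z - 1) - (b * y + b ^ 2 * y - b ^ 2 + b * m)) * r0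
      + 2 * (b * (1 - m)) * r1
  have h1 : w 1 = 0 := by
    refine (mul_eq_zero.1 ?_).resolve_left hdet
    linear_combination 2 * (2 * (z - 1) - (a * x - a ^ 2 - a * m + a ^ 2 * x)) * r1
      + 2 * (a * (1 + m)) * r0
  apply lp.ext
  funext j
  rw [lp.coeFn_zero, Pi.zero_apply]
  rcases le_or_gt j 0 with hj | hj
  · have := hl (-j).toNat
    have e : (-((-j).toNat : ℕ) : ℤ) = j := by omega
    simpa only [e, Nat.cast_zero, neg_zero, h0, zero_mul] using this
  · have := hr (j - 1).toNat
    have e : (((j - 1).toNat : ℕ) : ℤ) + 1 = j := by omega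
    simpa only [e, Nat.cast_zero, zero_add, h1, zero_mul] using this

/-- Whole-line solutions for the left and right coefficients are glued. The rows `j ≤ -1` and `j ≥
2` never read across the gluing point; adding decaying modes preserves them and corrects rows `0`
and `1`. -/
theorem resolvent_surjective [Fact (1 ≤ q)] (ha0 : 0 < a) (ha1 : a < 1) (hb0 : 0 < b)
    (hb1 : b < 1) (hm : |m| < 1) (hz : 1 ≤ ‖z‖) (hz1 : z ≠ 1) (g : SeqSpace q) :
    ∃ w : SeqSpace q, ∀ j, z * w j - linearizedSeq a m (-b) w j = g j := by
  obtain ⟨x, x', hx1, hx1', hx, hsx, hpx⟩ := exists_charRoots ha0 ha1 hz hz1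
  obtain ⟨y, y', hy1, hy1', hy, hsy, hpy⟩ := exists_charRoots hb0 hb1 hz hz1
  have hA : (a + a ^ 2 : ℂ) ≠ 0 := by
    have : a + a ^ 2 ≠ 0 := by positivity
    exact_mod_cast this
  have hB : (b + b ^ 2 : ℂ) ≠ 0 := by
    have : b + b ^ 2 ≠ 0 := by positivity
    exact_mod_cast this
  -- The shift is `-1` because `x` describes modes decaying towards `j → -∞`.
  obtain ⟨u, hu⟩ := exists_secondOrder hx1.ne hx1'.ne' (-1) ((-2 / (a + a ^ 2 : ℂ)) • g)
  obtain ⟨v, hv⟩ := exists_secondOrder hy1.ne hy1'.ne' 1 ((-2 / (b + b ^ 2 : ℂ)) • g)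
  have hu' : ∀ j, (a + a ^ 2) * u (j - 1) - (2 * a ^ 2 + 2 * (z - 1)) * u j
      + (a ^ 2 - a) * u (j + 1) = -2 * g j := by
    intro j
    have h := hu j
    have h2 : ((-2 / (a + a ^ 2 : ℂ)) • g : SeqSpace q) j = -2 / (a + a ^ 2 : ℂ) * g j := rfl
    rw [h2, sub_neg_eq_add, ← sub_eq_add_neg, div_mul_eq_mul_div, eq_div_iff hA] at h
    linear_combination h + u j * hsx - u (j + 1) * hpx
  have hv' : ∀ j, (b + b ^ 2) * v (j + 1) - (2 * b ^ 2 + 2 * (z - 1)) * v j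
      + (b ^ 2 - b) * v (j - 1) = -2 * g j := by
    intro j
    have h := hv j
    have h2 : ((-2 / (b + b ^ 2 : ℂ)) • g : SeqSpace q) j = -2 / (b + b ^ 2 : ℂ) * g j := rfl
    rw [h2, div_mul_eq_mul_div, eq_div_iff hB] at h
    linear_combination h + v j * hsy - v (j - 1) * hpy
  have hdet := lopatinskii_ne_zero ha0 ha1 hb0 hb1 hm hz hz1 hx hy hx1 hy1
  obtain ⟨p, r, hp, hr⟩ : ∃ p r : ℂ,
      (2 * (z - 1) - (a * x - a ^ 2 - a * m + a ^ 2 * x)) * p - b * (1 - m) * r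
        = 2 * g 0 - ((2 * (z - 1) + a * (a + m)) * u 0 - (a + a ^ 2) * u (-1)
          - b * (1 - m) * v 1) ∧
      (2 * (z - 1) - (b * y + b ^ 2 * y - b ^ 2 + b * m)) * r - a * (1 + m) * p
        = 2 * g 1 - ((2 * (z - 1) - b * (m - b)) * v 1 - (b + b ^ 2) * v 2
          - a * (1 + m) * u 0) := by
    generalize 2 * g 0 - ((2 * (z - 1) + a * (a + m)) * u 0 - (a + a ^ 2) * u (-1)
          - b * (1 - m) * v 1) = G
    generalize 2 * g 1 - ((2 * (z - 1) - b * (m - b)) * v 1 - (b + b ^ 2) * v 2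
          - a * (1 + m) * u 0) = H
    generalize (2 * (z - 1) - (a * x - a ^ 2 - a * m + a ^ 2 * x)) = α at hdet ⊢
    generalize (2 * (z - 1) - (b * y + b ^ 2 * y - b ^ 2 + b * m)) = β at hdet ⊢
    generalize (b * (1 - m) : ℂ) = γ at hdet ⊢
    generalize (a * (1 + m) : ℂ) = δ at hdet ⊢
    -- Cramer's rule for the amplitudes of the two decaying modes.
    refine ⟨(β * G + γ * H) / (α * β - γ * δ), (α * H + δ * G) / (α * β - γ * δ), ?_, ?_⟩
    all_goals
      generalize hd : α * β - γ * δ = d at hdet ⊢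
      field_simp
    · linear_combination G * hd
    · linear_combination H * hd
  have hmem := (memlp_glue (lp.memℓp u) (lp.memℓp v)).add
    (memlp_twoSidedGeom (q := q) Fact.out p r hx1 hy1)
  refine ⟨⟨_, hmem⟩, fun j => ?_⟩
  change z * ((fun j => if j ≤ 0 then u j else v j) + twoSidedGeom p x r y) j
    - linearizedSeq a m (-b) ((fun j => if j ≤ 0 then u j else v j) + twoSidedGeom p x r y) j = g j
  set w : ℤ → ℂ := (fun j => if j ≤ 0 then u j else v j) + twoSidedGeom p x r y with hw
  have hwl : ∀ j ≤ 0, w j = u j + p * x ^ (-j).toNat := by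
    intro j hj; simp [hw, twoSidedGeom, hj]
  have hwr : ∀ j, 1 ≤ j → w j = v j + r * y ^ (j - 1).toNat := by
    intro j hj
    have : ¬ j ≤ 0 := by omega
    simp [hw, twoSidedGeom, this]
  rcases le_or_gt j (-1) with hj | hj
  · obtain ⟨n, rfl⟩ : ∃ n : ℕ, j = -(n + 1) := ⟨(-j - 1).toNat, by omega⟩
    rw [linearizedSeq_of_le_neg_one _ _ _ _ hj, hwl _ (by omega), hwl (-(n + 1) + 1) (by omega),
      hwl (-(n + 1) - 1) (by omega)]
    have e1 : (-(-(n + 1 : ℤ))).toNat = n + 1 := by omega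
    have e2 : (-(-(n + 1 : ℤ) + 1)).toNat = n := by omega
    have e3 : (-(-(n + 1 : ℤ) - 1)).toNat = n + 2 := by omega
    rw [e1, e2, e3]
    unfold IsCharRoot at hx
    linear_combination (-1 / 2 : ℂ) * hu' (-(n + 1)) - p * x ^ n / 2 * hx
  rcases le_or_gt 2 j with hj2 | hj2
  · obtain ⟨n, rfl⟩ : ∃ n : ℕ, j = n + 2 := ⟨(j - 2).toNat, by omega⟩
    rw [linearizedSeq_of_two_le _ _ _ _ hj2, hwr _ (by omega), hwr (n + 2 + 1) (by omega),
      hwr (n + 2 - 1) (by omega)]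
    have e1 : (n + 2 - 1 : ℤ).toNat = n + 1 := by omega
    have e2 : (n + 2 + 1 - 1 : ℤ).toNat = n + 2 := by omega
    have e3 : (n + 2 - 1 - 1 : ℤ).toNat = n := by omega
    rw [e1, e2, e3]
    unfold IsCharRoot at hy
    linear_combination (-1 / 2 : ℂ) * hv' (n + 2) - r * y ^ n / 2 * hy
  have w0 : w 0 = u 0 + p := by simpa using hwl 0 le_rfl
  have w1 : w 1 = v 1 + r := by simpa using hwr 1 le_rfl
  have w2 : w 2 = v 2 + r * y := by simpa using hwr 2 (by norm_num)
  have wm : w (-1) = u (-1) + p * x := by simpa using hwl (-1) (by norm_num)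
  obtain rfl | rfl : j = 0 ∨ j = 1 := by omega
  · rw [linearizedSeq_zero, w0, w1, wm]
    linear_combination (1 / 2 : ℂ) * hp
  · rw [linearizedSeq_one, w0, w1, w2]
    linear_combination (1 / 2 : ℂ) * hr

/-- Outside the open unit disc, `1` is the only possible point of the spectrum. -/
theorem notMem_spectrum [Fact (1 ≤ q)] (ha0 : 0 < a) (ha1 : a < 1) (hb0 : 0 < b)
    (hb1 : b < 1) (hm : |m| < 1) (hz : 1 ≤ ‖z‖) (hz1 : z ≠ 1) :
    z ∉ spectrum ℂ (linearizedOp q a m (-b)) := by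
  rw [spectrum.notMem_iff, ContinuousLinearMap.isUnit_iff_bijective]
  constructor
  · rw [injective_iff_map_eq_zero]
    intro w hw
    exact resolvent_injective ha0 ha1 hb0 hb1 hm hz hz1 w fun j =>
      congrFun (congrArg (fun w : SeqSpace q => (w : ℤ → ℂ)) hw) j
  · intro g
    obtain ⟨w, hw⟩ := resolvent_surjective ha0 ha1 hb0 hb1 hm hz hz1 g
    exact ⟨w, lp.ext (funext hw)⟩

/-! ### The eigenvalue `1`. -/

theorem hasEigenvalue_one [Fact (1 ≤ q)] (ha0 : 0 < a) (ha1 : a < 1) (hb0 : 0 < b)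
    (hb1 : b < 1) (hm : |m| < 1) :
    Module.End.HasEigenvalue (linearizedOp q a m (-b) : Module.End ℂ (SeqSpace q)) 1 := by
  -- At `z = 1` the characteristic polynomial is `c (x - 1) ((1 + c) x - (c - 1))`; the root other
  -- than `1` decays.
  have hroot : ∀ c : ℝ, 0 < c → c < 1 → ∃ x : ℂ, ‖x‖ < 1 ∧ (1 + c) * x = c - 1 := by
    intro c h0 h1
    have hc : (1 + c : ℂ) ≠ 0 := by
      have : 1 + c ≠ 0 := by positivity
      exact_mod_cast this
    refine ⟨((c - 1) / (1 + c) : ℝ), ?_, by push_cast; field_simp⟩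
    rw [Complex.norm_real, Real.norm_eq_abs, abs_lt]
    constructor
    · rw [lt_div_iff₀ (by linarith)]; linarith
    · rw [div_lt_iff₀ (by linarith)]; linarith
  obtain ⟨x, hx1, hx⟩ := hroot a ha0 ha1
  obtain ⟨y, hy1, hy⟩ := hroot b hb0 hb1
  -- Both matching conditions reduce to `a (1 + m) p = b (1 - m) r`, which these amplitudes solve.
  set p : ℂ := b * (1 - m)
  set r : ℂ := a * (1 + m)
  have hmem := memlp_twoSidedGeom (q := q) Fact.out p r hx1 hy1
  refine Module.End.hasEigenvalue_of_hasEigenvector (x := ⟨_, hmem⟩) ⟨?_, ?_⟩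
  · rw [Module.End.mem_eigenspace_iff, one_smul]
    refine lp.ext (funext fun j => ?_)
    change linearizedSeq a m (-b) (twoSidedGeom p x r y) j = twoSidedGeom p x r y j
    set w := twoSidedGeom p x r y with hw
    have hwl : ∀ j ≤ 0, w j = p * x ^ (-j).toNat := by
      intro j hj; simp [hw, twoSidedGeom, hj]
    have hwr : ∀ j, 1 ≤ j → w j = r * y ^ (j - 1).toNat := by
      intro j hj
      have : ¬ j ≤ 0 := by omega
      simp [hw, twoSidedGeom, this]
    rcases le_or_gt j (-1) with hj | hj
    · obtain ⟨n, rfl⟩ : ∃ n : ℕ, j = -(n + 1) := ⟨(-j - 1).toNat, by omega⟩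
      rw [linearizedSeq_of_le_neg_one _ _ _ _ hj, hwl _ (by omega), hwl (-(n + 1) + 1) (by omega),
        hwl (-(n + 1) - 1) (by omega)]
      have e1 : (-(-(n + 1 : ℤ))).toNat = n + 1 := by omega
      have e2 : (-(-(n + 1 : ℤ) + 1)).toNat = n := by omega
      have e3 : (-(-(n + 1 : ℤ) - 1)).toNat = n + 2 := by omega
      rw [e1, e2, e3]
      linear_combination p * x ^ n * a * (x - 1) / 2 * hx
    rcases le_or_gt 2 j with hj2 | hj2
    · obtain ⟨n, rfl⟩ : ∃ n : ℕ, j = n + 2 := ⟨(j - 2).toNat, by omega⟩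
      rw [linearizedSeq_of_two_le _ _ _ _ hj2, hwr _ (by omega), hwr (n + 2 + 1) (by omega),
        hwr (n + 2 - 1) (by omega)]
      have e1 : (n + 2 - 1 : ℤ).toNat = n + 1 := by omega
      have e2 : (n + 2 + 1 - 1 : ℤ).toNat = n + 2 := by omega
      have e3 : (n + 2 - 1 - 1 : ℤ).toNat = n := by omega
      rw [e1, e2, e3]
      linear_combination r * y ^ n * b * (y - 1) / 2 * hy
    have w0 : w 0 = p := by simpa using hwl 0 le_rfl
    have w1 : w 1 = r := by simpa using hwr 1 le_rfl
    have w2 : w 2 = r * y := by simpa using hwr 2 (by norm_num)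
    have wm : w (-1) = p * x := by simpa using hwl (-1) (by norm_num)
    obtain rfl | rfl : j = 0 ∨ j = 1 := by omega
    · rw [linearizedSeq_zero, w0, w1, wm]
      simp only [p, r]
      linear_combination (a * (b * (1 - m)) / 2 : ℂ) * hx
    · rw [linearizedSeq_one, w0, w1, w2]
      simp only [p, r]
      linear_combination (b * (a * (1 + m)) / 2 : ℂ) * hy
  · intro h
    have h0 : twoSidedGeom p x r y 0 = 0 :=
      congrFun (congrArg (fun w : SeqSpace q => (w : ℤ → ℂ)) h) 0
    have h1 : ((b * (1 - m) : ℝ) : ℂ) = 0 := by simpa [twoSidedGeom, p] using h0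
    have h2 : b * (1 - m) = 0 := by exact_mod_cast h1
    have := mul_pos hb0 (sub_pos.2 (abs_lt.1 hm).2)
    linarith

/-! ### From the flux to the Courant numbers. -/

/-- For a convex or concave flux the derivative at the midpoint lies between its values at the two
end states of an entropic shock. -/
theorem deriv_midpoint_mem_Icc {f : ℝ → ℝ} (hf : Differentiable ℝ f)
    (hconv : ConvexOn ℝ Set.univ f ∨ ConcaveOn ℝ Set.univ f) {ul ur : ℝ}
    (h : deriv f ur < deriv f ul) :
    deriv f ((ul + ur) / 2) ∈ Set.Icc (deriv f ur) (deriv f ul) := by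
  rcases hconv with hc | hc
  · have hmono : Monotone (deriv f) :=
      monotoneOn_univ.1 (hc.monotoneOn_deriv fun x _ => hf x)
    have hlt : ur < ul := hmono.reflect_lt h
    exact ⟨hmono (by linarith), hmono (by linarith)⟩
  · have hanti : Antitone (deriv f) :=
      antitoneOn_univ.1 (hc.antitoneOn_deriv fun x _ => hf x)
    have hlt : ul < ur := hanti.reflect_lt h
    exact ⟨hanti (by linarith), hanti (by linarith)⟩

end LaxWendroff

theorem mainTheorem5 (f : ℝ → ℝ) (hf : ContDiff ℝ (⊤ : ℕ∞) f)
    (hconv : ConvexOn ℝ Set.univ f ∨ ConcaveOn ℝ Set.univ f)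
    (ul ur : ℝ) (hRH : f ul = f ur)
    (hentropy : deriv f ur < 0 ∧ 0 < deriv f ul)
    (lam : ℝ) (hlam : 0 < lam)
    (hCFL : max (LaxWendroff.courant f lam ul) |LaxWendroff.courant f lam ur| < 1)
    (q : ENNReal) [Fact (1 ≤ q)] :
    spectrum ℂ (LaxWendroff.linearizedOp q (LaxWendroff.courant f lam ul)
        (LaxWendroff.courant f lam ((ul + ur) / 2)) (LaxWendroff.courant f lam ur))
      ∩ ({z : ℂ | 1 ≤ ‖z‖} \ {1}) = ∅ ∧
    Module.End.HasEigenvalue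
      (LaxWendroff.linearizedOp q (LaxWendroff.courant f lam ul)
        (LaxWendroff.courant f lam ((ul + ur) / 2)) (LaxWendroff.courant f lam ur)
        : Module.End ℂ (LaxWendroff.SeqSpace q)) 1 := by
  obtain ⟨hr, hl⟩ := hentropy
  obtain ⟨hm1, hm2⟩ := LaxWendroff.deriv_midpoint_mem_Icc (hf.differentiable (by simp)) hconv
    (hr.trans hl)
  obtain ⟨hl1, hr1⟩ := max_lt_iff.1 hCFL
  have hl0 : 0 < LaxWendroff.courant f lam ul := mul_pos hlam hl
  have hr0 : LaxWendroff.courant f lam ur < 0 := mul_neg_of_pos_of_neg hlam hr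
  have hr2 := (abs_lt.1 hr1).1
  have hm1' : LaxWendroff.courant f lam ur ≤ LaxWendroff.courant f lam ((ul + ur) / 2) :=
    mul_le_mul_of_nonneg_left hm1 hlam.le
  have hm2' : LaxWendroff.courant f lam ((ul + ur) / 2) ≤ LaxWendroff.courant f lam ul :=
    mul_le_mul_of_nonneg_left hm2 hlam.le
  -- The midpoint Courant number lies between the end ones, both in `(-1, 1)`.
  have hm : |LaxWendroff.courant f lam ((ul + ur) / 2)| < 1 :=
    abs_lt.2 ⟨by linarith, by linarith⟩
  rw [← neg_neg (LaxWendroff.courant f lam ur)]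
  constructor
  · rw [Set.eq_empty_iff_forall_notMem]
    rintro z ⟨hz, hz1, hz2⟩
    exact LaxWendroff.notMem_spectrum hl0 hl1 (by linarith) (by linarith) hm hz1 hz2 hz
  · exact LaxWendroff.hasEigenvalue_one hl0 hl1 (by linarith) (by linarith) hm
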